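/- Fix a number of arms $K$, a threshold $\tau\in\mathbb{R}$ and $R>0$. A problem instance $(M,\mu)$ consists of a vector $\mu\in\mathbb{R}^K$ of mean rewards and a matrix $M\in[0,1]^{K\times K}$ with $M_{ij}=1-M_{ji}$, such that, with the Borda scores $p_i=\frac{1}{K-1}\sum_{j\neq i}M_{ij}$, every positive arm ($\mu_i\ge\tau$) has a strictly larger Borda score than every negative arm ($\mu_j<\tau$). In each round a (possibly randomized) sequential algorithm may pull an arm $i$, observing an independent $\mathcal N(\mu_i,R^2)$ reward, or duel two arms $i,j$, observing an independent Bernoulli$(M_{ij})$ outcome, or stop and output a set of arms as its guess of the set $S$ of positive arms. For an instance having positive and negative arms let $i_u$ be a positive arm of least Borda score and $i_l$ a negative arm of largest Borda score; put $\Delta^c_i=p_i-p_{i_u}$ for positive $i$, $\Delta^c_i=p_{i_l}-p_i$ for negative $i$, and $$H_{c,1}=\sum_{i\notin\{i_u,i_l\}}\frac{1}{(\Delta^c_i)^2}\in[0,\infty]\qquad(1/0=\infty).$$ Let $0<\delta\le 0.15$ and $c=\min\{\frac1{10},\frac{R^2}{2}\}$. Let $a,b$ be two arms and let $\mathcal{A}$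 be an algorithm that is told that $a$ is positive and $b$ is negative, that uses only duels, and that is $\delta$-correct: on every problem instance in which $a$ is positive and $b$ is negative, the probability that $\mathcal A$ stops and outputs a set other than $S$ is at most $\delta$. (This holds in particular if $\mathcal A$ stops and outputs $S$ with probability at least $1-\delta$ on all those instances.) Then, for every problem instance $(M,\mu)$ such that $M_{ij}\ge\frac38$ for all $i,j\in[K]$, and such that $a$ and $b$ are a worst positive arm $i_u$ and a best negative arm $i_l$ of it, the expected number of duels of $\mathcal A$ satisfies $$\mathbb{E}_{M,\mu}\big[n_{\mathrm{duel}}^{\mathcal A}\big]\;\ge\; c\,H_{c,1}\,\log\frac{1}{2\delta}.$$ -/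

import Mathlib

open MeasureTheory ProbabilityTheory
open scoped ENNReal

namespace TBPDC

/-- A query: pull one arm, or duel two arms. -/
inductive Query (K : ℕ) where
  | pull (i : Fin K)
  | duel (i j : Fin K)

/-- In each round an algorithm either makes a query, or halts and declares the arms of `S` to be
the positive ones (and all other arms to be negative). -/
inductive Decision (K : ℕ) where
  | query (q : Query K)
  | halt (S : Finset (Fin K))

/-- The Borda score `p_i = (K - 1)⁻¹ ∑_{j ≠ i} M_ij`. -/
noncomputable def bordaScore {K : ℕ} (M : Fin K → Fin K → unitInterval) (i : Fin K) : ℝ :=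
  (∑ j ∈ Finset.univ.erase i, (M i j : ℝ)) / ((K : ℝ) - 1)

/-- A problem instance `(M, μ)` with `K` arms and threshold `τ`: `M i j` is the probability that arm
`i` wins a duel against arm `j`, and `μ i` is the mean reward of arm `i`. The Borda score of any
positive arm (`τ ≤ μ i`) exceeds the Borda score of any negative arm (`μ j < τ`). -/
structure Problem (K : ℕ) (τ : ℝ) where
  M : Fin K → Fin K → unitInterval
  μ : Fin K → ℝ
  M_symm : ∀ i j, (M i j : ℝ) = 1 - M j i
  separated : ∀ i j, τ ≤ μ i → μ j < τ → bordaScore M j < bordaScore M i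

namespace Problem

variable {K : ℕ} {τ : ℝ}

/-- The set of positive arms. -/
noncomputable def pos (I : Problem K τ) : Finset (Fin K) :=
  Finset.univ.filter fun i => τ ≤ I.μ i

/-- The Borda score of arm `i`. -/
noncomputable def p (I : Problem K τ) (i : Fin K) : ℝ := bordaScore I.M i

/-- `u` is a positive arm of least Borda score. -/
def IsWorstPositive (I : Problem K τ) (u : Fin K) : Prop :=
  u ∈ I.pos ∧ ∀ j ∈ I.pos, I.p u ≤ I.p j

/-- `l` is a negative arm of largest Borda score. -/
def IsBestNegative (I : Problem K τ) (l : Fin K) : Prop :=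
  l ∉ I.pos ∧ ∀ j, j ∉ I.pos → I.p j ≤ I.p l

/-- The duel gap of arm `i`, relative to the worst positive arm `u` and the best negative
arm `l`. -/
noncomputable def gap (I : Problem K τ) (u l i : Fin K) : ℝ :=
  if i ∈ I.pos then I.p i - I.p u else I.p l - I.p i

/-- The duel complexity `H_{c,1} = ∑_{i ≠ u, l} 1 / gap_i ^ 2`, an extended nonnegative real:
an arm (other than `u` and `l`) of gap `0` contributes `∞`. -/
noncomputable def Hc1 (I : Problem K τ) (u l : Fin K) : ℝ≥0∞ :=
  ∑ i ∈ (Finset.univ.erase u).erase l, (ENNReal.ofReal (I.gap u l i ^ 2))⁻¹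

/-- The law of the answer to a query: a pull of arm `i` returns a reward with law `N(μ_i, R²)`,
a duel of `i` and `j` returns `1` (arm `i` wins) with probability `M_ij` and `0` otherwise. -/
noncomputable def answerLaw (I : Problem K τ) (R : ℝ) : Query K → Measure ℝ
  | .pull i => gaussianReal (I.μ i) (R ^ 2).toNNReal
  | .duel i j => bernoulliMeasure 1 0 (I.M i j)

instance (I : Problem K τ) (R : ℝ) (q : Query K) : IsProbabilityMeasure (I.answerLaw R q) := by
  cases q <;> unfold answerLaw <;> infer_instance

/-- The randomness of a run: the internal random seed of the algorithm (with law `ρ`) and,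
independent of it and of one another, an answer for every round `t` and every query `q`. In each
round the algorithm sees only the answer to the query that it makes, so that, given the past, this
is a fresh sample of the law of that query. -/
noncomputable def runLaw {Ξ : Type*} [MeasurableSpace Ξ] (I : Problem K τ) (R : ℝ)
    (ρ : Measure Ξ) : Measure (Ξ × (ℕ × Query K → ℝ)) :=
  ρ.prod (Measure.infinitePi fun tq : ℕ × Query K => I.answerLaw R tq.2)

end Problem

/-- A sequential, possibly randomized algorithm for `K` arms with seeds in `Ξ`: the decision in
round `t` is a measurable function of the seed and of the answers in the rounds before `t` (these
determine the earlier queries as well). -/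
structure Algorithm (K : ℕ) (Ξ : Type*) [MeasurableSpace Ξ] where
  next : (t : ℕ) → Ξ × (Fin t → ℝ) → Decision K
  measurable_next : ∀ (t : ℕ) (d : Decision K), MeasurableSet {x | next t x = d}

namespace Algorithm

variable {K : ℕ} {Ξ : Type*} [MeasurableSpace Ξ]

/-- The algorithm never makes a pull. -/
def UsesOnlyDuels (A : Algorithm K Ξ) : Prop :=
  ∀ t x i, A.next t x ≠ .query (.pull i)

/-- The answers received in the rounds before round `t` (with the dummy value `0` in rounds in which
no query is made; what follows the first `halt` is never used). -/
def history (A : Algorithm K Ξ) (x : Ξ × (ℕ × Query K → ℝ)) : (t : ℕ) → Fin t → ℝ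
  | 0 => Fin.elim0
  | t + 1 => Fin.snoc (α := fun _ => ℝ) (A.history x t)
      (match A.next t (x.1, A.history x t) with
        | .query q => x.2 (t, q)
        | .halt _ => 0)

/-- The decision in round `t`. -/
def decision (A : Algorithm K Ξ) (x : Ξ × (ℕ × Query K → ℝ)) (t : ℕ) : Decision K :=
  A.next t (x.1, A.history x t)

/-- Round `t` is reached: the algorithm does not halt before it. -/
def Reaches (A : Algorithm K Ξ) (x : Ξ × (ℕ × Query K → ℝ)) (t : ℕ) : Prop :=
  ∀ s < t, ∀ S, A.decision x s ≠ .halt S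

/-- The algorithm terminates and declares `S` to be the set of positive arms. -/
def Outputs (A : Algorithm K Ξ) (x : Ξ × (ℕ × Query K → ℝ)) (S : Finset (Fin K)) : Prop :=
  ∃ t, A.Reaches x t ∧ A.decision x t = .halt S

open Classical in
/-- The number of duels that are made before termination. -/
noncomputable def numDuels (A : Algorithm K Ξ) (x : Ξ × (ℕ × Query K → ℝ)) : ℝ≥0∞ :=
  ∑' t : ℕ, if A.Reaches x t ∧ ∃ i j, A.decision x t = .query (.duel i j) then 1 else 0

/-- On the instance `I`, the algorithm terminates with a wrong answer with probability at
most `δ`. (Terminating with the right answer with probability at least `1 - δ` implies this.) -/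
def ErrsAtMost {τ : ℝ} (A : Algorithm K Ξ) (ρ : Measure Ξ) (R δ : ℝ) (I : Problem K τ) : Prop :=
  I.runLaw R ρ {x | ∃ S, A.Outputs x S ∧ S ≠ I.pos} ≤ ENNReal.ofReal δ

/-- The expected number of duels on the instance `I`. -/
noncomputable def expectedDuels {τ : ℝ} (A : Algorithm K Ξ) (ρ : Measure Ξ) (R : ℝ)
    (I : Problem K τ) : ℝ≥0∞ :=
  ∫⁻ x, A.numDuels x ∂(I.runLaw R ρ)

end Algorithm

end TBPDC

/-!
Fix an arm `i` other than `u` and `l`. Lowering (if `i` is positive) or raising (if it is negative)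
its winning probabilities by its gap (by any positive amount if the gap is `0`) carries it past all
other arms of its own kind, since their Borda scores move slightly in the opposite direction. So the
sign of `i` can be flipped: this gives an instance on which `u` is positive and `l` negative as
before, but on which the old answer is wrong. Hence the old answer has probability at least `1 - δ`
under the first instance (if the expected number of duels is finite) and at most `δ` under the
second one, and the entropy of the transcript must be at least `kl (1 - δ, δ)`. Only duels with `i`
contribute to that entropy, each at most a constant times the squared gap, because all probabilities
stay away from `0` and `1`. Each duel involves at most two arms, so summing over `i` bounds the
total number of duels.

The change of measure avoids likelihood ratios: the inequality
`log a * P (E) ≤ log (1 + (a - 1) * Q (E)) + KL (P, Q)` is the Donsker-Varadhan variational formula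
for the function `log a * 1_E`, and for a sequential experiment it follows from the case of a single
Bernoulli answer by backward induction on the number of remaining rounds.
-/

open Filter Set
open scoped NNReal Topology

namespace TBPDC

/-! ### Binary relative entropy -/

/-- The relative entropy of the Bernoulli law with parameter `p` with respect to the one with
parameter `q`; it stands for a relative entropy only if `p` and `q` lie in `(0, 1)`. -/
noncomputable def bernoulliKL (p q : ℝ) : ℝ :=
  p * Real.log (p / q) + (1 - p) * Real.log ((1 - p) / (1 - q))

theorem bernoulliKL_self (p : ℝ) : bernoulliKL p p = 0 := by
  simp [bernoulliKL, Real.log_div_self]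

theorem bernoulliKL_one_sub_one_sub (p q : ℝ) :
    bernoulliKL (1 - p) (1 - q) = bernoulliKL p q := by
  simp only [bernoulliKL, sub_sub_cancel]
  exact add_comm _ _

theorem hasDerivAt_bernoulliKL {p q : ℝ} (hp : p ∈ Ioo 0 1) (hq : q ∈ Ioo 0 1) :
    HasDerivAt (bernoulliKL p) ((q - p) / (q * (1 - q))) q := by
  obtain ⟨hp0, hp1⟩ := hp
  obtain ⟨hq0, hq1⟩ := hq
  have hp1' : 1 - p ≠ 0 := by linarith
  have hq1' : 1 - q ≠ 0 := by linarith
  have h₁ : HasDerivAt (fun y => p * Real.log (p / y)) _ q :=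
    (((hasDerivAt_const q p).fun_div (hasDerivAt_id' q) hq0.ne').log
      (div_ne_zero hp0.ne' hq0.ne')).const_mul p
  have h₂ : HasDerivAt (fun y => (1 - p) * Real.log ((1 - p) / (1 - y))) _ q :=
    (((hasDerivAt_const q (1 - p)).fun_div ((hasDerivAt_id' q).const_sub 1) hq1').log
      (div_ne_zero hp1' hq1')).const_mul (1 - p)
  refine (h₁.fun_add h₂).congr_deriv ?_
  have := hp0.ne'
  have := hq0.ne'
  field_simp
  ring

theorem exists_bernoulliKL_eq_sq_div {p q : ℝ} (hp : 0 < p) (hpq : p < q) (hq : q < 1) :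
    ∃ c ∈ Ioo p q, bernoulliKL p q = (p - q) ^ 2 / (2 * (c * (1 - c))) := by
  have hderiv : ∀ y ∈ Icc p q, HasDerivAt (bernoulliKL p) ((y - p) / (y * (1 - y))) y := fun y hy =>
    hasDerivAt_bernoulliKL ⟨hp, hpq.trans hq⟩ ⟨hp.trans_le hy.1, hy.2.trans_lt hq⟩
  obtain ⟨c, hc, h⟩ := exists_ratio_hasDerivAt_eq_ratio_slope (bernoulliKL p) _ hpq
    (fun y hy => (hderiv y hy).continuousAt.continuousWithinAt)
    (fun y hy => hderiv y (Ioo_subset_Icc_self hy)) (fun y => (y - p) ^ 2) (fun y => 2 * (y - p))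
    (by fun_prop) fun y _ => by simpa using ((hasDerivAt_id' y).sub_const p).fun_pow 2
  refine ⟨c, hc, ?_⟩
  have hc0 : 0 < c := hp.trans hc.1
  have hc1 : 0 < 1 - c := by linarith [hc.2]
  have hcp : 0 < c - p := by linarith [hc.1]
  simp only [sub_self, bernoulliKL_self] at h
  field_simp at h ⊢
  linarith

theorem mul_one_sub_le_mul_one_sub {w p : ℝ} (hp : p ∈ Icc w (1 - w)) :
    w * (1 - w) ≤ p * (1 - p) := by
  nlinarith [mul_nonneg (sub_nonneg.mpr hp.1) (sub_nonneg.mpr hp.2)]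

theorem bernoulliKL_le_sq_div {p q w : ℝ} (hw : 0 < w) (hp : p ∈ Icc w (1 - w))
    (hq : q ∈ Icc w (1 - w)) : bernoulliKL p q ≤ (p - q) ^ 2 / (2 * (w * (1 - w))) := by
  wlog hpq : p ≤ q generalizing p q
  · have hsymm {r : ℝ} (hr : r ∈ Icc w (1 - w)) : 1 - r ∈ Icc w (1 - w) :=
      ⟨by linarith [hr.2], by linarith [hr.1]⟩
    have h := this (hsymm hp) (hsymm hq) (by linarith)
    rw [bernoulliKL_one_sub_one_sub] at h
    exact h.trans_eq (by ring)
  rcases hpq.eq_or_lt with rfl | hlt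
  · simp [bernoulliKL_self]
  obtain ⟨c, ⟨hpc, hcq⟩, h⟩ :=
    exists_bernoulliKL_eq_sq_div (hw.trans_le hp.1) hlt (by linarith [hq.2])
  have hvar := mul_one_sub_le_mul_one_sub ⟨hp.1.trans hpc.le, hcq.le.trans hq.2⟩
  have hw1 : 0 < 1 - w := by linarith [hp.1, hp.2]
  rw [h]
  gcongr

theorem bernoulli_donsker_varadhan {p q a b : ℝ} (hp : p ∈ Ioo 0 1) (hq : q ∈ Ioo 0 1)
    (ha : 0 < a) (hb : 0 < b) :
    p * Real.log a + (1 - p) * Real.log b ≤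
      Real.log (q * a + (1 - q) * b) + bernoulliKL p q := by
  obtain ⟨hp0, hp1⟩ := hp
  obtain ⟨hq0, hq1⟩ := hq
  have hp1' : 0 < 1 - p := by linarith
  have hq1' : 0 < 1 - q := by linarith
  have hpq := div_pos hp0 hq0
  have hpq' := div_pos hp1' hq1'
  have h := strictConcaveOn_log_Ioi.concaveOn.2 (mem_Ioi.mpr (div_pos ha hpq))
    (mem_Ioi.mpr (div_pos hb hpq')) hp0.le hp1'.le (by ring)
  have hmean : p * (a / (p / q)) + (1 - p) * (b / ((1 - p) / (1 - q))) = q * a + (1 - q) * b := by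
    field_simp
  simp only [smul_eq_mul] at h
  rw [hmean, Real.log_div ha.ne' hpq.ne', Real.log_div hb.ne' hpq'.ne'] at h
  unfold bernoulliKL
  linarith

theorem mul_average_le_log_average_add_bernoulliKL {p q c L v₁ v₀ w₁ w₀ k₁ k₀ : ℝ}
    (hp : p ∈ Ioo 0 1) (hq : q ∈ Ioo 0 1) (hv₁ : 0 < 1 + c * v₁) (hv₀ : 0 < 1 + c * v₀)
    (h₁ : L * w₁ ≤ Real.log (1 + c * v₁) + k₁) (h₀ : L * w₀ ≤ Real.log (1 + c * v₀) + k₀) :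
    L * (p * w₁ + (1 - p) * w₀) ≤
      Real.log (1 + c * (q * v₁ + (1 - q) * v₀)) +
        (bernoulliKL p q + (p * k₁ + (1 - p) * k₀)) := by
  have hdv := bernoulli_donsker_varadhan hp hq hv₁ hv₀
  have harg : q * (1 + c * v₁) + (1 - q) * (1 + c * v₀) = 1 + c * (q * v₁ + (1 - q) * v₀) := by
    ring
  rw [harg] at hdv
  linarith [mul_le_mul_of_nonneg_left h₁ hp.1.le,
    mul_le_mul_of_nonneg_left h₀ (sub_nonneg.mpr hp.2.le)]

theorem bernoulliKL_one_sub_self (δ : ℝ) :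
    bernoulliKL (1 - δ) δ = (1 - 2 * δ) * Real.log ((1 - δ) / δ) := by
  rw [bernoulliKL, sub_sub_cancel, ← inv_div (1 - δ) δ, Real.log_inv]
  ring

theorem log_le_log_add_div_sub_one {y z : ℝ} (hy : 0 < y) (hz : 0 < z) :
    Real.log y ≤ Real.log z + (y / z - 1) := by
  have h := Real.log_le_sub_one_of_pos (div_pos hy hz)
  rw [Real.log_div hy.ne' hz.ne'] at h
  linarith

theorem log_one_div_two_mul_le_bernoulliKL {δ : ℝ} (hδ0 : 0 < δ) (hδ : δ ≤ 0.15) :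
    Real.log (1 / (2 * δ)) ≤ bernoulliKL (1 - δ) δ := by
  -- Bounding `log (3 / 20)` by the tangent of `log` at `δ`, and `log (1 - δ)` by monotonicity,
  -- leaves a decreasing affine function of `δ`, which is still nonnegative at `3 / 20`.
  norm_num at hδ
  have hδ1 : 0 < 1 - δ := by linarith
  have h_first : 2 * δ * Real.log (3 / 20) ≤ 2 * δ * Real.log δ + (3 / 10 - 2 * δ) := by
    refine (mul_le_mul_of_nonneg_left (log_le_log_add_div_sub_one (by norm_num) hδ0)
      (by positivity)).trans_eq ?_
    field_simp
    ring
  have h_second : (1 - 2 * δ) * Real.log (17 / 20) ≤ (1 - 2 * δ) * Real.log (1 - δ) := by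
    gcongr <;> linarith
  have h_slope : Real.log (3 / 20) - Real.log (17 / 20) ≤ -1 := by
    rw [← Real.log_div (by norm_num) (by norm_num), Real.log_le_iff_le_exp (by norm_num),
      Real.exp_neg, le_inv_comm₀ (by norm_num) (Real.exp_pos 1)]
    exact Real.exp_one_lt_d9.le.trans (by norm_num)
  have h_endpoint : 0 ≤ 3 * Real.log (3 / 20) + 7 * Real.log (17 / 20) + 10 * Real.log 2 := by
    have h := Real.log_nonneg (show (1 : ℝ) ≤ (3 / 20) ^ 3 * (17 / 20) ^ 7 * 2 ^ 10 by norm_num)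
    rw [Real.log_mul (by norm_num) (by norm_num), Real.log_mul (by norm_num) (by norm_num),
      Real.log_pow, Real.log_pow, Real.log_pow] at h
    exact_mod_cast h
  rw [bernoulliKL_one_sub_self, one_div, Real.log_inv, Real.log_mul two_ne_zero hδ0.ne',
    Real.log_div hδ1.ne' hδ0.ne']
  nlinarith [mul_nonneg (sub_nonneg.mpr hδ) (sub_nonneg.mpr h_slope)]

-- For `g = 0` the factor `(g ^ 2)⁻¹` is `∞`, and `x → 0` in the hypothesis forces `L = 0`.
theorem inv_sq_mul_le {g b : ℝ} {L E : ℝ≥0∞} (hg : 0 ≤ g) (hgb : g ≤ b) (hb : 0 < b)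
    (h : ∀ x, 0 < x → x ≤ b → g ≤ x → L ≤ ENNReal.ofReal (x ^ 2) * E) :
    (ENNReal.ofReal (g ^ 2))⁻¹ * L ≤ E := by
  rcases hg.eq_or_lt with rfl | hpos
  · rcases eq_or_ne E ∞ with rfl | hE
    · exact le_top
    have hlim : Tendsto (fun x : ℝ => ENNReal.ofReal (x ^ 2) * E) (𝓝[>] 0) (𝓝 0) := by
      have h0 : Tendsto (fun x : ℝ => ENNReal.ofReal (x ^ 2)) (𝓝[>] 0) (𝓝 0) := by
        have hc : Continuous fun x : ℝ => ENNReal.ofReal (x ^ 2) :=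
          ENNReal.continuous_ofReal.comp (continuous_pow 2)
        simpa using (hc.tendsto 0).mono_left nhdsWithin_le_nhds
      simpa using ENNReal.Tendsto.mul_const h0 (.inr hE)
    have hL : L ≤ 0 := ge_of_tendsto hlim <| by
      filter_upwards [Ioc_mem_nhdsGT hb] with x hx using h x hx.1 hx.2 hx.1.le
    simp [nonpos_iff_eq_zero.mp hL]
  · exact (ENNReal.inv_mul_le_iff (by simpa using hpos.ne') ENNReal.ofReal_ne_top).mpr
      (h g hpos hgb le_rfl)

/-! ### Expected payoffs of sequential algorithms -/

theorem measurePreserving_piecewise_infinitePi {ι : Type*} {X : ι → Type*}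
    [∀ i, MeasurableSpace (X i)] (ν : ∀ i, Measure (X i)) [∀ i, IsProbabilityMeasure (ν i)]
    (s : Set ι) [DecidablePred (· ∈ s)] :
    MeasurePreserving (fun z : (∀ i, X i) × (∀ i, X i) => s.piecewise z.1 z.2)
      ((Measure.infinitePi ν).prod (Measure.infinitePi ν)) (Measure.infinitePi ν) := by
  have hmeas : Measurable fun z : (∀ i, X i) × (∀ i, X i) => s.piecewise z.1 z.2 := by
    refine measurable_pi_lambda _ fun i => ?_
    by_cases hi : i ∈ s <;> simp only [piecewise, hi, if_true, if_false] <;> fun_prop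
  refine ⟨hmeas, Measure.eq_infinitePi ν fun F t ht => ?_⟩
  have hpre : (fun z : (∀ i, X i) × (∀ i, X i) => s.piecewise z.1 z.2) ⁻¹' (pi F t) =
      (pi (F.filter (· ∈ s)) t) ×ˢ (pi (F.filter (· ∉ s)) t) := by
    ext z
    simp only [mem_preimage, Set.mem_pi, mem_prod, Finset.mem_coe, Finset.mem_filter, piecewise]
    grind
  rw [Measure.map_apply hmeas (.pi F.countable_toSet fun i _ => ht i), hpre, Measure.prod_prod,
    Measure.infinitePi_pi ν fun i _ => ht i, Measure.infinitePi_pi ν fun i _ => ht i,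
    Finset.prod_filter_mul_prod_filter_not]

theorem lintegral_bernoulliMeasure {X : Type*} [MeasurableSpace X] (x y : X) (p : unitInterval)
    {f : X → ℝ≥0∞} (hf : Measurable f) :
    ∫⁻ z, f z ∂(bernoulliMeasure x y p) =
      (unitInterval.toNNReal p : ℝ≥0∞) * f x +
        (unitInterval.toNNReal (unitInterval.symm p) : ℝ≥0∞) * f y := by
  rw [bernoulliMeasure_def, lintegral_add_measure, lintegral_smul_measure, lintegral_smul_measure,
    lintegral_dirac' _ hf, lintegral_dirac' _ hf]
  rfl

theorem measurable_finSnoc (t : ℕ) :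
    Measurable fun z : (Fin t → ℝ) × ℝ => (Fin.snoc (α := fun _ => ℝ) z.1 z.2 : Fin (t + 1) → ℝ) :=
  (continuous_fst.finSnoc continuous_snd).measurable

variable {K : ℕ} {τ : ℝ} {Ξ : Type*} [MeasurableSpace Ξ]

instance : Countable (Query K) :=
  Function.Surjective.countable (f := Sum.elim Query.pull fun ij : Fin K × Fin K => .duel ij.1 ij.2)
    (by rintro (i | ⟨i, j⟩); exacts [⟨.inl i, rfl⟩, ⟨.inr (i, j), rfl⟩])

instance : Countable (Decision K) :=
  Function.Surjective.countable (f := Sum.elim Decision.query Decision.halt)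
    (by rintro (q | S); exacts [⟨.inl q, rfl⟩, ⟨.inr S, rfl⟩])

instance : MeasurableSpace (Decision K) := ⊤

instance : DiscreteMeasurableSpace (Decision K) := ⟨fun _ => trivial⟩

namespace Decision

/-- The entry of the history that results from a decision in round `t`. -/
def answer (t : ℕ) (ω : ℕ × Query K → ℝ) : Decision K → ℝ
  | .query q => ω (t, q)
  | .halt _ => 0

/-- The mean continuation payoff after a decision when the duel probabilities are `M`, for a
continuation worth `a` if the first arm of a duel wins and `b` if the second one does. Pulls are
treated like `halt`, with continuation `0`: only algorithms without pulls are considered. -/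
noncomputable def mean (M : Fin K → Fin K → unitInterval) (a b : ℝ≥0) : Decision K → ℝ≥0
  | .query (.duel i j) =>
    unitInterval.toNNReal (M i j) * a + unitInterval.toNNReal (unitInterval.symm (M i j)) * b
  | _ => 0

theorem coe_mean_duel (M : Fin K → Fin K → unitInterval) (i j : Fin K) (a b : ℝ≥0) :
    ((Decision.query (.duel i j)).mean M a b : ℝ) = M i j * a + (1 - M i j) * b := by
  simp [mean]

/-- The decisions to hold a duel. -/
def duels : Set (Decision K) := {d | ∃ i j, d = .query (.duel i j)}

/-- The decisions to hold a duel in which arm `i` takes part. -/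
def duelsOf (i : Fin K) : Set (Decision K) :=
  {d | ∃ a b, d = .query (.duel a b) ∧ (a = i ∨ b = i)}

theorem query_duel_mem_duelsOf {a b i : Fin K} :
    .query (.duel a b) ∈ duelsOf i ↔ a = i ∨ b = i := by
  simp [duelsOf]

/-- The payoff that makes the mean total payoff the probability of the output `S`. -/
noncomputable abbrev haltPayoff (S : Finset (Fin K)) : Decision K → ℝ≥0 :=
  ({.halt S} : Set (Decision K)).indicator 1

/-- The relative entropy, of the answer to a decision under `M` with respect to `N`. Only duels
count: the answer to a pull is left out. -/
noncomputable def answerKL (M N : Fin K → Fin K → unitInterval) : Decision K → ℝ≥0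
  | .query (.duel i j) => (bernoulliKL (M i j) (N i j)).toNNReal
  | _ => 0

theorem measurable_answer (t : ℕ) :
    Measurable fun z : Decision K × (ℕ × Query K → ℝ) => z.1.answer t z.2 := by
  refine measurable_from_prod_countable_right fun d => ?_
  cases d with
  | query q => exact measurable_pi_apply _
  | halt S => exact measurable_const

theorem measurable_mean (M : Fin K → Fin K → unitInterval) :
    Measurable fun z : Decision K × (ℝ≥0 × ℝ≥0) => z.1.mean M z.2.1 z.2.2 := by
  refine measurable_from_prod_countable_right fun d => ?_
  rcases d with (_ | ⟨i, j⟩) | _ <;> simp only [mean] <;> fun_prop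

end Decision

namespace Problem

instance (I : Problem K τ) (R : ℝ) (ρ : Measure Ξ) [IsProbabilityMeasure ρ] :
    IsProbabilityMeasure (I.runLaw R ρ) := by
  unfold runLaw
  infer_instance

theorem lintegral_runLaw_resample (I : Problem K τ) (R : ℝ) (ρ : Measure Ξ)
    [IsProbabilityMeasure ρ] (s : Set (ℕ × Query K)) [DecidablePred (· ∈ s)]
    {f : Ξ × (ℕ × Query K → ℝ) → ℝ≥0∞} (hf : Measurable f) :
    ∫⁻ x, f x ∂(I.runLaw R ρ) =
      ∫⁻ x, ∫⁻ η, f (x.1, s.piecewise x.2 η)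
        ∂(Measure.infinitePi fun tq : ℕ × Query K => I.answerLaw R tq.2) ∂(I.runLaw R ρ) := by
  have hp := measurePreserving_piecewise_infinitePi
    (fun tq : ℕ × Query K => I.answerLaw R tq.2) s
  have hg : Measurable fun z : (Ξ × (ℕ × Query K → ℝ)) × (ℕ × Query K → ℝ) =>
      f (z.1.1, s.piecewise z.1.2 z.2) :=
    hf.comp ((measurable_fst.comp measurable_fst).prodMk (hp.measurable.comp
      ((measurable_snd.comp measurable_fst).prodMk measurable_snd)))
  unfold runLaw
  rw [lintegral_prod _ hf.aemeasurable, lintegral_prod _ hg.lintegral_prod_right'.aemeasurable]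
  refine lintegral_congr fun ξ => ?_
  have hfξ : Measurable fun ω => f (ξ, ω) := hf.comp measurable_prodMk_left
  rw [← hp.lintegral_comp hfξ]
  exact lintegral_prod _ (hfξ.comp hp.measurable).aemeasurable

theorem lintegral_answer_duel (I : Problem K τ) (R : ℝ) (t : ℕ) (i j : Fin K) {h : ℝ → ℝ≥0}
    (hh : Measurable h) :
    ∫⁻ η, h (η (t, .duel i j))
        ∂(Measure.infinitePi fun tq : ℕ × Query K => I.answerLaw R tq.2) =
      (Decision.query (.duel i j)).mean I.M (h 1) (h 0) := by
  have heval := (measurePreserving_eval_infinitePi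
    (fun tq : ℕ × Query K => I.answerLaw R tq.2) (t, .duel i j)).lintegral_comp
      hh.coe_nnreal_ennreal
  simp only [Function.eval] at heval
  rw [heval, answerLaw, lintegral_bernoulliMeasure _ _ _ hh.coe_nnreal_ennreal]
  simp only [Decision.mean, ENNReal.coe_add, ENNReal.coe_mul]

end Problem

namespace Algorithm

theorem history_succ (A : Algorithm K Ξ) (x : Ξ × (ℕ × Query K → ℝ)) (t : ℕ) :
    A.history x (t + 1) =
      Fin.snoc (α := fun _ => ℝ) (A.history x t) ((A.decision x t).answer t x.2) := by
  rw [history, decision]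
  cases A.next t (x.1, A.history x t) <;> rfl

theorem reaches_zero (A : Algorithm K Ξ) (x : Ξ × (ℕ × Query K → ℝ)) : A.Reaches x 0 :=
  fun s hs => absurd hs s.not_lt_zero

theorem reaches_succ (A : Algorithm K Ξ) (x : Ξ × (ℕ × Query K → ℝ)) (t : ℕ) :
    A.Reaches x (t + 1) ↔ A.Reaches x t ∧ ∀ S, A.decision x t ≠ .halt S :=
  Nat.forall_lt_succ_right

theorem measurable_next' (A : Algorithm K Ξ) (t : ℕ) : Measurable (A.next t) :=
  measurable_to_countable' fun d => A.measurable_next t d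

theorem measurable_history (A : Algorithm K Ξ) (t : ℕ) :
    Measurable fun x : Ξ × (ℕ × Query K → ℝ) => A.history x t := by
  induction t with
  | zero => exact measurable_pi_lambda _ fun i => i.elim0
  | succ t ih =>
    simp only [history_succ]
    have hd : Measurable fun x : Ξ × (ℕ × Query K → ℝ) => A.decision x t :=
      (A.measurable_next' t).comp (measurable_fst.prodMk ih)
    exact (measurable_finSnoc t).comp
      (ih.prodMk ((Decision.measurable_answer t).comp (hd.prodMk measurable_snd)))

theorem measurable_decision (A : Algorithm K Ξ) (t : ℕ) :
    Measurable fun x : Ξ × (ℕ × Query K → ℝ) => A.decision x t :=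
  (A.measurable_next' t).comp (measurable_fst.prodMk (A.measurable_history t))

theorem measurableSet_reaches (A : Algorithm K Ξ) (t : ℕ) :
    MeasurableSet {x : Ξ × (ℕ × Query K → ℝ) | A.Reaches x t} := by
  simp only [Reaches, ofPred_forall]
  exact .iInter fun s => .iInter fun _ => .iInter fun S =>
    (A.measurable_decision s (.singleton (Decision.halt S))).compl

theorem measurableSet_reaches_and_decision_mem (A : Algorithm K Ξ) (t : ℕ) (B : Set (Decision K)) :
    MeasurableSet {x | A.Reaches x t ∧ A.decision x t ∈ B} :=
  (A.measurableSet_reaches t).inter (A.measurable_decision t .of_discrete)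

theorem history_congr (A : Algorithm K Ξ) {ξ : Ξ} {ω ω' : ℕ × Query K → ℝ} {t : ℕ}
    (h : ∀ s < t, ∀ q, ω (s, q) = ω' (s, q)) : A.history (ξ, ω) t = A.history (ξ, ω') t := by
  induction t with
  | zero => rfl
  | succ t ih =>
    have ih' := ih fun s hs => h s (hs.trans t.lt_succ_self)
    have hd : A.decision (ξ, ω) t = A.decision (ξ, ω') t := by simp only [decision, ih']
    rw [history_succ, history_succ, ih', hd]
    congr 1
    cases A.decision (ξ, ω') t with
    | query q => exact h t t.lt_succ_self q
    | halt S => rfl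

theorem decision_congr (A : Algorithm K Ξ) {ξ : Ξ} {ω ω' : ℕ × Query K → ℝ} {t : ℕ}
    (h : ∀ s < t, ∀ q, ω (s, q) = ω' (s, q)) : A.decision (ξ, ω) t = A.decision (ξ, ω') t := by
  simp only [decision, A.history_congr h]

theorem reaches_congr (A : Algorithm K Ξ) {ξ : Ξ} {ω ω' : ℕ × Query K → ℝ} {t : ℕ}
    (h : ∀ s < t, ∀ q, ω (s, q) = ω' (s, q)) : A.Reaches (ξ, ω) t ↔ A.Reaches (ξ, ω') t := by
  refine forall₂_congr fun s hs => ?_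
  rw [A.decision_congr fun r hr => h r (hr.trans hs)]

theorem setLIntegral_reaches_succ (A : Algorithm K Ξ) (hA : A.UsesOnlyDuels) (I : Problem K τ)
    (R : ℝ) (ρ : Measure Ξ) [IsProbabilityMeasure ρ] (t : ℕ) {G : Ξ × (Fin (t + 1) → ℝ) → ℝ≥0}
    (hG : Measurable G) :
    ∫⁻ x in {x | A.Reaches x (t + 1)}, G (x.1, A.history x (t + 1)) ∂(I.runLaw R ρ) =
      ∫⁻ x in {x | A.Reaches x t}, (A.decision x t).mean I.M
        (G (x.1, Fin.snoc (α := fun _ => ℝ) (A.history x t) 1))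
        (G (x.1, Fin.snoc (α := fun _ => ℝ) (A.history x t) 0)) ∂(I.runLaw R ρ) := by
  classical
  have hmeas : Measurable fun x : Ξ × (ℕ × Query K → ℝ) =>
      (G (x.1, A.history x (t + 1)) : ℝ≥0∞) :=
    (hG.comp (measurable_fst.prodMk (A.measurable_history (t + 1)))).coe_nnreal_ennreal
  rw [← lintegral_indicator (A.measurableSet_reaches _),
    ← lintegral_indicator (A.measurableSet_reaches _),
    I.lintegral_runLaw_resample R ρ {s | s.1 < t} (hmeas.indicator (A.measurableSet_reaches _))]
  refine lintegral_congr fun ⟨ξ, ω⟩ => ?_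
  have hpast (η : ℕ × Query K → ℝ) : ∀ s < t, ∀ q,
      ({s | s.1 < t} : Set (ℕ × Query K)).piecewise ω η (s, q) = ω (s, q) :=
    fun s hs q => piecewise_eq_of_mem _ _ _ hs
  simp only [indicator_apply, mem_ofPred_eq, reaches_succ, history_succ,
    A.reaches_congr (hpast _), A.decision_congr (hpast _), A.history_congr (hpast _)]
  by_cases hr : A.Reaches (ξ, ω) t
  swap
  · simp [hr]
  rcases hd : A.decision (ξ, ω) t with (i | ⟨i, j⟩) | S
  · exact absurd hd (hA t _ i)
  · have hh : Measurable fun y : ℝ =>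
        G (ξ, Fin.snoc (α := fun _ => ℝ) (A.history (ξ, ω) t) y) :=
      hG.comp (measurable_const.prodMk
        ((measurable_finSnoc t).comp (measurable_const.prodMk measurable_id)))
    simpa [hr, Decision.answer, piecewise] using I.lintegral_answer_duel R t i j hh
  · simp [Decision.mean]

/-- The mean total payoff of the next `m` rounds before termination, given the seed and the answers
before round `t`, when a decision `d` pays `g d` and no pull is ever made. -/
noncomputable def value (A : Algorithm K Ξ) (M : Fin K → Fin K → unitInterval)
    (g : Decision K → ℝ≥0) : ℕ → (t : ℕ) → Ξ × (Fin t → ℝ) → ℝ≥0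
  | 0, _, _ => 0
  | m + 1, t, x => g (A.next t x) + (A.next t x).mean M
      (value A M g m (t + 1) (x.1, Fin.snoc (α := fun _ => ℝ) x.2 1))
      (value A M g m (t + 1) (x.1, Fin.snoc (α := fun _ => ℝ) x.2 0))

theorem measurable_value (A : Algorithm K Ξ) (M : Fin K → Fin K → unitInterval)
    (g : Decision K → ℝ≥0) (m t : ℕ) : Measurable (A.value M g m t) := by
  induction m generalizing t with
  | zero => exact measurable_const
  | succ m ih =>
    have hsnoc (y : ℝ) : Measurable fun x : Ξ × (Fin t → ℝ) =>
        A.value M g m (t + 1) (x.1, Fin.snoc (α := fun _ => ℝ) x.2 y) :=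
      (ih (t + 1)).comp (measurable_fst.prodMk
        ((measurable_finSnoc t).comp (measurable_snd.prodMk measurable_const)))
    exact ((measurable_of_countable g).comp (A.measurable_next' t)).add
      ((Decision.measurable_mean M).comp
        ((A.measurable_next' t).prodMk ((hsnoc 1).prodMk (hsnoc 0))))

theorem setLIntegral_value (A : Algorithm K Ξ) (hA : A.UsesOnlyDuels) (I : Problem K τ) (R : ℝ)
    (ρ : Measure Ξ) [IsProbabilityMeasure ρ] (g : Decision K → ℝ≥0) (m t : ℕ) :
    ∫⁻ x in {x | A.Reaches x t}, A.value I.M g m t (x.1, A.history x t) ∂(I.runLaw R ρ) =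
      ∑ s ∈ Finset.range m,
        ∫⁻ x in {x | A.Reaches x (t + s)}, g (A.decision x (t + s)) ∂(I.runLaw R ρ) := by
  induction m generalizing t with
  | zero => simp [value]
  | succ m ih =>
    have hg : Measurable fun x : Ξ × (ℕ × Query K → ℝ) => (g (A.decision x t) : ℝ≥0∞) :=
      ((measurable_of_countable g).comp (A.measurable_decision t)).coe_nnreal_ennreal
    simp only [value, ENNReal.coe_add]
    refine (lintegral_add_left hg _).trans ?_
    rw [Finset.sum_range_succ', add_comm]
    congr 1
    refine (A.setLIntegral_reaches_succ hA I R ρ t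
      (A.measurable_value I.M g m (t + 1))).symm.trans ?_
    simp only [ih (t + 1), add_right_comm t 1, add_assoc t _ 1]

/-- The occupation measure of a run whose randomness has law `P`: the expected number of rounds, up
to and including the one that halts, in which the decision lies in a given set. -/
noncomputable def occupation (A : Algorithm K Ξ) (P : Measure (Ξ × (ℕ × Query K → ℝ))) :
    Measure (Decision K) :=
  Measure.sum fun t => (P.restrict {x | A.Reaches x t}).map fun x => A.decision x t

theorem lintegral_occupation (A : Algorithm K Ξ) (P : Measure (Ξ × (ℕ × Query K → ℝ)))
    (f : Decision K → ℝ≥0∞) :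
    ∫⁻ d, f d ∂(A.occupation P) =
      ∑' t, ∫⁻ x in {x | A.Reaches x t}, f (A.decision x t) ∂P := by
  simp only [occupation, lintegral_sum_measure,
    lintegral_map (measurable_of_countable f) (A.measurable_decision _)]

theorem occupation_apply (A : Algorithm K Ξ) (P : Measure (Ξ × (ℕ × Query K → ℝ)))
    (B : Set (Decision K)) :
    A.occupation P B = ∑' t, P {x | A.Reaches x t ∧ A.decision x t ∈ B} := by
  rw [occupation, Measure.sum_apply _ .of_discrete]
  refine tsum_congr fun t => ?_
  rw [Measure.map_apply (A.measurable_decision t) .of_discrete,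
    Measure.restrict_apply (A.measurable_decision t .of_discrete), inter_comm]
  rfl

theorem occupation_halt (A : Algorithm K Ξ) (P : Measure (Ξ × (ℕ × Query K → ℝ)))
    (S : Finset (Fin K)) : A.occupation P {.halt S} = P {x | A.Outputs x S} := by
  have hdisj : Pairwise (Function.onFun Disjoint
      fun t => {x | A.Reaches x t ∧ A.decision x t ∈ ({.halt S} : Set (Decision K))}) := by
    refine (pairwise_disjoint_on _).mpr fun s t hst => disjoint_left.mpr ?_
    exact fun x hs ht => ht.1 s hst S hs.2
  rw [occupation_apply, ← measure_iUnion hdisj fun t =>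
    A.measurableSet_reaches_and_decision_mem t _]
  congr 1
  ext x
  simp [Outputs]

theorem numDuels_eq_tsum_indicator (A : Algorithm K Ξ) (x : Ξ × (ℕ × Query K → ℝ)) :
    A.numDuels x =
      ∑' t, {x | A.Reaches x t ∧ A.decision x t ∈ Decision.duels}.indicator 1 x := by
  classical
  simp only [numDuels, indicator_apply, Pi.one_apply]
  congr!

theorem measurable_numDuels (A : Algorithm K Ξ) : Measurable A.numDuels := by
  rw [funext A.numDuels_eq_tsum_indicator]
  exact Measurable.tsum fun t =>
    measurable_one.indicator (A.measurableSet_reaches_and_decision_mem t _)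

theorem occupation_duels (A : Algorithm K Ξ) (P : Measure (Ξ × (ℕ × Query K → ℝ))) :
    A.occupation P Decision.duels = ∫⁻ x, A.numDuels x ∂P := by
  have hmeas (t : ℕ) := A.measurableSet_reaches_and_decision_mem t Decision.duels
  simp only [numDuels_eq_tsum_indicator]
  rw [occupation_apply,
    lintegral_tsum fun t => (measurable_one.indicator (hmeas t)).aemeasurable]
  exact tsum_congr fun t => (lintegral_indicator_one (hmeas t)).symm

theorem lintegral_occupation_eq_iSup_value (A : Algorithm K Ξ) (hA : A.UsesOnlyDuels)
    (I : Problem K τ) (R : ℝ) (ρ : Measure Ξ) [IsProbabilityMeasure ρ] (g : Decision K → ℝ≥0) :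
    ∫⁻ d, g d ∂(A.occupation (I.runLaw R ρ)) =
      ⨆ m, ∫⁻ ξ, A.value I.M g m 0 (ξ, Fin.elim0) ∂ρ := by
  rw [lintegral_occupation, ENNReal.tsum_eq_iSup_nat]
  refine iSup_congr fun m => ?_
  have h := A.setLIntegral_value hA I R ρ g m 0
  have huniv : {x | A.Reaches x 0} = univ := eq_univ_of_forall A.reaches_zero
  simp only [zero_add, huniv, Measure.restrict_univ] at h
  rw [← h, Problem.runLaw, lintegral_prod]
  · simp [history]
  · exact ((A.measurable_value I.M g m 0).comp
      (measurable_fst.prodMk (A.measurable_history 0))).coe_nnreal_ennreal.aemeasurable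

/-! ### Change of measure -/

open Decision (haltPayoff answerKL)

-- Backward induction: each round costs one use of the Donsker-Varadhan inequality.
theorem log_mul_value_le (A : Algorithm K Ξ) {M N : Fin K → Fin K → unitInterval}
    (hM : ∀ i j, (M i j : ℝ) ∈ Ioo 0 1) (hN : ∀ i j, (N i j : ℝ) ∈ Ioo 0 1)
    (S : Finset (Fin K)) {a : ℝ} (ha : 1 ≤ a) (m t : ℕ) (x : Ξ × (Fin t → ℝ)) :
    Real.log a * A.value M (haltPayoff S) m t x ≤
      Real.log (1 + (a - 1) * A.value N (haltPayoff S) m t x) + A.value M (answerKL M N) m t x := by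
  have : 0 ≤ a - 1 := sub_nonneg.mpr ha
  induction m generalizing t with
  | zero => simp [value]
  | succ m ih =>
    simp only [value]
    rcases A.next t x with (i | ⟨i, j⟩) | S'
    · simp [Decision.mean, answerKL]
    · have hhalt : haltPayoff S (.query (.duel i j)) = 0 :=
        indicator_of_notMem (by simp) 1
      simp only [hhalt, zero_add, NNReal.coe_add, Decision.coe_mean_duel, answerKL]
      refine (mul_average_le_log_average_add_bernoulliKL (hM i j) (hN i j) (by positivity)
        (by positivity) (ih (t + 1) _) (ih (t + 1) _)).trans ?_
      gcongr
      exact Real.le_coe_toNNReal _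
    · by_cases h : S' = S <;> simp [Decision.mean, answerKL, h]

theorem iSup_lintegral_value_halt (A : Algorithm K Ξ) (hA : A.UsesOnlyDuels) (I : Problem K τ)
    (R : ℝ) (ρ : Measure Ξ) [IsProbabilityMeasure ρ] (S : Finset (Fin K)) :
    ⨆ m, ∫⁻ ξ, A.value I.M (haltPayoff S) m 0 (ξ, Fin.elim0) ∂ρ =
      I.runLaw R ρ {x | A.Outputs x S} := by
  rw [← A.lintegral_occupation_eq_iSup_value hA I R ρ, ← occupation_halt,
    ← lintegral_indicator_one .of_discrete]
  exact lintegral_congr fun d => by by_cases h : d = .halt S <;> simp [h]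

-- The tangent of `log` at `z` makes the bound affine in the value, so that it can be integrated
-- term by term over the seed; the `1` on the left replaces a subtraction on the right.
theorem ofReal_log_mul_value_add_one_le (A : Algorithm K Ξ) {M N : Fin K → Fin K → unitInterval}
    (hM : ∀ i j, (M i j : ℝ) ∈ Ioo 0 1) (hN : ∀ i j, (N i j : ℝ) ∈ Ioo 0 1)
    (S : Finset (Fin K)) {a z : ℝ} (ha : 1 ≤ a) (hz : 1 ≤ z) (m t : ℕ) (x : Ξ × (Fin t → ℝ)) :
    ENNReal.ofReal (Real.log a) * A.value M (haltPayoff S) m t x + 1 ≤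
      ENNReal.ofReal (Real.log z + 1 / z) + ENNReal.ofReal ((a - 1) / z) *
          A.value N (haltPayoff S) m t x +
        A.value M (answerKL M N) m t x := by
  have h := A.log_mul_value_le hM hN S ha m t x
  generalize A.value M (haltPayoff S) m t x = w at h ⊢
  generalize A.value N (haltPayoff S) m t x = v at h ⊢
  generalize A.value M (answerKL M N) m t x = k at h ⊢
  have : 0 ≤ a - 1 := sub_nonneg.mpr ha
  have hlog_a := Real.log_nonneg ha
  have hlog_z := Real.log_nonneg hz
  have htangent := log_le_log_add_div_sub_one (by positivity : 0 < 1 + (a - 1) * v)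
    (zero_lt_one.trans_le hz)
  rw [add_div, mul_div_right_comm] at htangent
  simp only [← ENNReal.ofReal_coe_nnreal, ← ENNReal.ofReal_one]
  rw [← ENNReal.ofReal_mul hlog_a, ← ENNReal.ofReal_mul (by positivity),
    ← ENNReal.ofReal_add (by positivity) (by positivity),
    ← ENNReal.ofReal_add (by positivity) (by positivity),
    ← ENNReal.ofReal_add (by positivity) (by positivity)]
  exact ENNReal.ofReal_le_ofReal (by linarith)

theorem ofReal_log_mul_runLaw_outputs_le (A : Algorithm K Ξ) (hA : A.UsesOnlyDuels)
    {I J : Problem K τ} (hI : ∀ i j, (I.M i j : ℝ) ∈ Ioo 0 1)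
    (hJ : ∀ i j, (J.M i j : ℝ) ∈ Ioo 0 1) (R : ℝ) (ρ : Measure Ξ) [IsProbabilityMeasure ρ]
    (S : Finset (Fin K)) {a q : ℝ} (ha : 1 ≤ a) (hq : 0 ≤ q)
    (hJq : J.runLaw R ρ {x | A.Outputs x S} ≤ ENNReal.ofReal q) :
    ENNReal.ofReal (Real.log a) * I.runLaw R ρ {x | A.Outputs x S} ≤
      ENNReal.ofReal (Real.log (1 + (a - 1) * q)) +
        ∫⁻ d, answerKL I.M J.M d ∂(A.occupation (I.runLaw R ρ)) := by
  set z := 1 + (a - 1) * q with hz_def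
  have : 0 ≤ a - 1 := sub_nonneg.mpr ha
  have hz : 1 ≤ z := le_add_of_nonneg_right (by positivity)
  have hz0 : z ≠ 0 := (zero_lt_one.trans_le hz).ne'
  have hmeas (M : Fin K → Fin K → unitInterval) (g : Decision K → ℝ≥0) (m : ℕ) :
      Measurable fun ξ : Ξ => (A.value M g m 0 (ξ, Fin.elim0) : ℝ≥0∞) :=
    ((A.measurable_value M g m 0).comp measurable_prodMk_right).coe_nnreal_ennreal
  have hconst : ENNReal.ofReal (Real.log z + 1 / z) +
      ENNReal.ofReal ((a - 1) / z) * ENNReal.ofReal q = ENNReal.ofReal (Real.log z) + 1 := by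
    have hlog := Real.log_nonneg hz
    rw [← ENNReal.ofReal_mul (by positivity), ← ENNReal.ofReal_add (by positivity) (by positivity),
      ← ENNReal.ofReal_one, ← ENNReal.ofReal_add hlog zero_le_one]
    congr 1
    field_simp
    linarith
  rw [← A.iSup_lintegral_value_halt hA, ENNReal.mul_iSup]
  refine iSup_le fun m => (ENNReal.add_le_add_iff_right ENNReal.one_ne_top).mp ?_
  have hint := lintegral_mono (μ := ρ) fun ξ =>
    A.ofReal_log_mul_value_add_one_le hI hJ S ha hz m 0 (ξ, Fin.elim0)
  rw [lintegral_add_right _ measurable_const, lintegral_add_right _ (hmeas _ _ _),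
    lintegral_add_left measurable_const, lintegral_const_mul _ (hmeas _ _ _),
    lintegral_const_mul _ (hmeas _ _ _), lintegral_const, lintegral_const, measure_univ, mul_one,
    mul_one] at hint
  refine hint.trans ?_
  rw [add_right_comm (ENNReal.ofReal (Real.log z)), ← hconst,
    A.lintegral_occupation_eq_iSup_value hA]
  gcongr
  · rw [← A.iSup_lintegral_value_halt hA] at hJq
    exact (le_iSup _ m).trans hJq
  · exact le_iSup (fun m => ∫⁻ ξ, A.value I.M (answerKL I.M J.M) m 0 (ξ, Fin.elim0) ∂ρ) m

theorem ofReal_bernoulliKL_le_lintegral_answerKL (A : Algorithm K Ξ) (hA : A.UsesOnlyDuels)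
    {I J : Problem K τ} (hI : ∀ i j, (I.M i j : ℝ) ∈ Ioo 0 1)
    (hJ : ∀ i j, (J.M i j : ℝ) ∈ Ioo 0 1) (R : ℝ) (ρ : Measure Ξ) [IsProbabilityMeasure ρ]
    {S : Finset (Fin K)} {δ : ℝ} (hδ0 : 0 < δ) (hδ : δ ≤ 1 / 2)
    (hIS : ENNReal.ofReal (1 - δ) ≤ I.runLaw R ρ {x | A.Outputs x S})
    (hJS : J.runLaw R ρ {x | A.Outputs x S} ≤ ENNReal.ofReal δ) :
    ENNReal.ofReal (bernoulliKL (1 - δ) δ) ≤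
      ∫⁻ d, answerKL I.M J.M d ∂(A.occupation (I.runLaw R ρ)) := by
  -- For the weight `a = r ^ 2`, `1 + (a - 1) * δ` equals `r`, and the bound becomes the entropy.
  set r := (1 - δ) / δ with hr
  have hr1 : 1 ≤ r := (one_le_div hδ0).mpr (by linarith)
  have hlog := Real.log_nonneg hr1
  have h := A.ofReal_log_mul_runLaw_outputs_le hA hI hJ R ρ S (one_le_pow₀ hr1 (n := 2)) hδ0.le hJS
  have hmix : 1 + (r ^ 2 - 1) * δ = r := by
    rw [hr]
    field_simp
    ring
  have hsplit : Real.log (r ^ 2) * (1 - δ) = Real.log r + bernoulliKL (1 - δ) δ := by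
    rw [bernoulliKL_one_sub_self, Real.log_pow, ← hr]
    push_cast
    ring
  have hKL : 0 ≤ bernoulliKL (1 - δ) δ := by
    rw [bernoulliKL_one_sub_self]
    exact mul_nonneg (by linarith) hlog
  rw [hmix] at h
  refine (ENNReal.add_le_add_iff_left (ENNReal.ofReal_ne_top (r := Real.log r))).mp ?_
  refine le_trans ?_ h
  rw [← ENNReal.ofReal_add hlog hKL, ← hsplit,
    ENNReal.ofReal_mul (Real.log_nonneg (one_le_pow₀ hr1))]
  gcongr

end Algorithm

/-! ### Flipping the sign of an arm -/

theorem sum_measure_duelsOf_le (ν : Measure (Decision K)) (T : Finset (Fin K)) :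
    ∑ i ∈ T, ν (Decision.duelsOf i) ≤ 2 * ν Decision.duels := by
  classical
  simp only [← lintegral_indicator_one (.of_discrete : MeasurableSet (_ : Set (Decision K)))]
  rw [← lintegral_finsetSum _ fun i _ => measurable_of_countable _,
    ← lintegral_const_mul _ (measurable_of_countable _)]
  refine lintegral_mono fun d => ?_
  rcases d with (i | ⟨a, b⟩) | S
  · simp [Decision.duelsOf]
  · have hsub : T.filter (fun i => Decision.query (.duel a b) ∈ Decision.duelsOf i) ⊆ {a, b} := by
      intro i hi
      simpa [Decision.query_duel_mem_duelsOf, eq_comm] using (Finset.mem_filter.mp hi).2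
    have hcard : (T.filter fun i => Decision.query (.duel a b) ∈ Decision.duelsOf i).card ≤ 2 :=
      (Finset.card_le_card hsub).trans Finset.card_le_two
    simpa [indicator_apply, Decision.duels] using mod_cast hcard
  · simp [Decision.duelsOf]

theorem bordaScore_mem_Icc (hK : 1 < K) {M : Fin K → Fin K → unitInterval} {v w : ℝ}
    (hM : ∀ a b, (M a b : ℝ) ∈ Icc v w) (a : Fin K) : bordaScore M a ∈ Icc v w := by
  have hK' : (0 : ℝ) < K - 1 := sub_pos.mpr (mod_cast hK)
  have hcard : ((Finset.univ.erase a).card : ℝ) = (K : ℝ) - 1 := by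
    simp [Finset.card_erase_of_mem, Nat.cast_sub hK.le]
  rw [bordaScore, mem_Icc, le_div_iff₀ hK', div_le_iff₀ hK', mul_comm, mul_comm w, ← hcard,
    ← nsmul_eq_mul, ← nsmul_eq_mul]
  exact ⟨Finset.card_nsmul_le_sum _ _ _ fun b _ => (hM a b).1,
    Finset.sum_le_card_nsmul _ _ _ fun b _ => (hM a b).2⟩

/-- The duel probabilities after arm `i` gives up `y` to each opponent, clipped to `[0, 1]`. -/
noncomputable def shift (M : Fin K → Fin K → unitInterval) (i : Fin K) (y : ℝ) (a b : Fin K) :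
    unitInterval :=
  projIcc 0 1 zero_le_one (M a b + y * ((if b = i then 1 else 0) - if a = i then 1 else 0))

section Shift

variable {M : Fin K → Fin K → unitInterval} {y w : ℝ}

theorem abs_mul_ite_sub_ite_le (i a b : Fin K) (y : ℝ) :
    |y * ((if b = i then 1 else 0) - if a = i then 1 else 0)| ≤ |y| := by
  split_ifs <;> simp

theorem coe_shift (hM : ∀ a b, (M a b : ℝ) ∈ Icc |y| (1 - |y|)) (i a b : Fin K) :
    (shift M i y a b : ℝ) =
      M a b + y * ((if b = i then 1 else 0) - if a = i then 1 else 0) := by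
  have h := abs_le.mp (abs_mul_ite_sub_ite_le i a b y)
  exact congrArg Subtype.val (projIcc_of_mem zero_le_one
    ⟨by linarith [(hM a b).1], by linarith [(hM a b).2]⟩)

theorem shift_mem_Icc (hw : 0 ≤ w) (hM : ∀ a b, (M a b : ℝ) ∈ Icc (w + |y|) (1 - (w + |y|)))
    (i a b : Fin K) : (shift M i y a b : ℝ) ∈ Icc w (1 - w) := by
  have h := abs_le.mp (abs_mul_ite_sub_ite_le i a b y)
  rw [coe_shift fun a b => ⟨by linarith [(hM a b).1], by linarith [(hM a b).2]⟩]
  exact ⟨by linarith [(hM a b).1], by linarith [(hM a b).2]⟩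

theorem bordaScore_shift_self (hK : 1 < K) (hM : ∀ a b, (M a b : ℝ) ∈ Icc |y| (1 - |y|))
    (i : Fin K) : bordaScore (shift M i y) i = bordaScore M i - y := by
  have hK' : (K : ℝ) - 1 ≠ 0 := (sub_pos.mpr (mod_cast hK)).ne'
  have hsum : ∑ b ∈ Finset.univ.erase i, (shift M i y i b : ℝ) =
      ∑ b ∈ Finset.univ.erase i, ((M i b : ℝ) - y) :=
    Finset.sum_congr rfl fun b hb => by
      rw [coe_shift hM, if_neg (Finset.ne_of_mem_erase hb), if_pos rfl]
      ring
  rw [bordaScore, hsum, Finset.sum_sub_distrib, sub_div, Finset.sum_const,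
    Finset.card_erase_of_mem (Finset.mem_univ i), Finset.card_fin, nsmul_eq_mul,
    Nat.cast_sub hK.le, Nat.cast_one, mul_div_cancel_left₀ y hK', bordaScore]

theorem bordaScore_shift_of_ne (hM : ∀ a b, (M a b : ℝ) ∈ Icc |y| (1 - |y|)) {i a : Fin K}
    (ha : a ≠ i) : bordaScore (shift M i y) a = bordaScore M a + y / ((K : ℝ) - 1) := by
  simp [bordaScore, coe_shift hM, ha, ha.symm, Finset.sum_add_distrib, add_div]

theorem lintegral_answerKL_shift_le (ν : Measure (Decision K)) (hw : 0 < w)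
    (hM : ∀ a b, (M a b : ℝ) ∈ Icc (w + |y|) (1 - (w + |y|))) (i : Fin K) :
    ∫⁻ d, Decision.answerKL M (shift M i y) d ∂ν ≤
      ENNReal.ofReal (y ^ 2 / (2 * (w * (1 - w)))) * ν (Decision.duelsOf i) := by
  have hy := abs_nonneg y
  have hM_y (a b : Fin K) : (M a b : ℝ) ∈ Icc |y| (1 - |y|) :=
    ⟨by linarith [(hM a b).1], by linarith [(hM a b).2]⟩
  have hM_w (a b : Fin K) : (M a b : ℝ) ∈ Icc w (1 - w) :=
    ⟨by linarith [(hM a b).1], by linarith [(hM a b).2]⟩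
  rw [← lintegral_indicator_const .of_discrete]
  refine lintegral_mono fun d => ?_
  rcases d with (j | ⟨a, b⟩) | S
  · simp [Decision.answerKL]
  · have hKL := bernoulliKL_le_sq_div hw (hM_w a b) (shift_mem_Icc hw.le hM i a b)
    simp only [Decision.answerKL]
    by_cases h : a = i ∨ b = i
    · rw [indicator_of_mem (Decision.query_duel_mem_duelsOf.mpr h)]
      refine ENNReal.ofReal_le_ofReal (hKL.trans ?_)
      have hw1 : 0 ≤ 1 - w := by linarith [(hM_w a b).1, (hM_w a b).2]
      gcongr ?_ / _
      rw [coe_shift hM_y, sub_add_cancel_left, neg_sq, sq_le_sq]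
      exact abs_mul_ite_sub_ite_le i a b y
    · rw [not_or] at h
      have hsame : (shift M i y a b : ℝ) = M a b := by simp [coe_shift hM_y, h]
      simp [hsame, bernoulliKL_self]
  · simp [Decision.answerKL]

end Shift

namespace Problem

theorem mem_pos {I : Problem K τ} {i : Fin K} : i ∈ I.pos ↔ τ ≤ I.μ i := by
  simp [pos]

theorem M_mem_Icc (I : Problem K τ) {w : ℝ} (hM : ∀ a b, w ≤ I.M a b) (a b : Fin K) :
    (I.M a b : ℝ) ∈ Icc w (1 - w) :=
  ⟨hM a b, by linarith [hM b a, I.M_symm a b]⟩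

theorem one_lt_of_mem_pos_of_notMem_pos {I : Problem K τ} {u l : Fin K} (hu : u ∈ I.pos)
    (hl : l ∉ I.pos) : 1 < K := by
  simpa using Fintype.one_lt_card_iff.mpr ⟨u, l, ne_of_mem_of_not_mem hu hl⟩

theorem gap_nonneg {I : Problem K τ} {u l : Fin K} (hu : I.IsWorstPositive u)
    (hl : I.IsBestNegative l) (i : Fin K) : 0 ≤ I.gap u l i := by
  unfold gap
  split_ifs with h
  · exact sub_nonneg.mpr (hu.2 i h)
  · exact sub_nonneg.mpr (hl.2 i h)

theorem gap_le {I : Problem K τ} {u l : Fin K} (hu : u ∈ I.pos) (hl : l ∉ I.pos) {w : ℝ}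
    (hM : ∀ a b, w ≤ I.M a b) (i : Fin K) : I.gap u l i ≤ 1 - 2 * w := by
  have hp (a : Fin K) : I.p a ∈ Icc w (1 - w) :=
    bordaScore_mem_Icc (one_lt_of_mem_pos_of_notMem_pos hu hl) (I.M_mem_Icc hM) a
  unfold gap
  split_ifs <;> linarith [(hp i).1, (hp i).2, (hp u).1, (hp l).2]

theorem lt_half_of_le_M {I : Problem K τ} {u l : Fin K} (hu : u ∈ I.pos) (hl : l ∉ I.pos) {w : ℝ}
    (hM : ∀ a b, w ≤ I.M a b) : w < 1 / 2 := by
  have hp (a : Fin K) : bordaScore I.M a ∈ Icc w (1 - w) :=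
    bordaScore_mem_Icc (one_lt_of_mem_pos_of_notMem_pos hu hl) (I.M_mem_Icc hM) a
  have hsep := I.separated u l (mem_pos.mp hu) (not_le.mp (mt mem_pos.mpr hl))
  linarith [(hp l).1, (hp u).2]

theorem bordaScore_shift_lt {I : Problem K τ} {u l i : Fin K} (hu : I.IsWorstPositive u)
    (hl : I.IsBestNegative l) {x : ℝ} (hx : 0 < x) (hgap : I.gap u l i ≤ x) {y : ℝ}
    (hy : y = if i ∈ I.pos then x else -x) (hM : ∀ a b, (I.M a b : ℝ) ∈ Icc |y| (1 - |y|))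
    {a b : Fin K} (ha : a ∈ symmDiff I.pos {i}) (hb : b ∉ symmDiff I.pos {i}) :
    bordaScore (shift I.M i y) b < bordaScore (shift I.M i y) a := by
  have hK := one_lt_of_mem_pos_of_notMem_pos hu.1 hl.1
  have hdiv : 0 < x / ((K : ℝ) - 1) := div_pos hx (sub_pos.mpr (mod_cast hK))
  simp only [Finset.mem_symmDiff, Finset.mem_singleton] at ha hb
  rcases eq_or_ne a i with rfl | hai
  · have hba : b ≠ a := by grind
    have hbl := hl.2 b (by grind)
    have haneg : a ∉ I.pos := by grind
    rw [bordaScore_shift_self hK hM, bordaScore_shift_of_ne hM hba]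
    simp only [gap, p, haneg, if_false] at hgap hbl hy
    rw [hy, neg_div]
    linarith
  rcases eq_or_ne b i with rfl | hbi
  · have hua := hu.2 a (by grind)
    have hbpos : b ∈ I.pos := by grind
    rw [bordaScore_shift_self hK hM, bordaScore_shift_of_ne hM hai]
    simp only [gap, p, hbpos, if_true] at hgap hua hy
    rw [hy]
    linarith
  · rw [bordaScore_shift_of_ne hM hai, bordaScore_shift_of_ne hM hbi]
    have hapos : a ∈ I.pos := by grind
    have hbneg : b ∉ I.pos := by grind
    gcongr
    exact I.separated a b (mem_pos.mp hapos) (not_le.mp (mt mem_pos.mpr hbneg))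

theorem exists_flip {I : Problem K τ} {u l i : Fin K} (hu : I.IsWorstPositive u)
    (hl : I.IsBestNegative l) {x : ℝ} (hx : 0 < x) (hgap : I.gap u l i ≤ x)
    (hM : ∀ a b, x ≤ I.M a b) :
    ∃ (J : Problem K τ) (y : ℝ), |y| = x ∧ J.M = shift I.M i y ∧ J.pos = symmDiff I.pos {i} := by
  obtain ⟨y, hy⟩ : ∃ y, y = if i ∈ I.pos then x else -x := ⟨_, rfl⟩
  have hyx : |y| = x := by rw [hy]; split_ifs <;> simp [abs_of_pos hx]
  have hMy (a b : Fin K) : (I.M a b : ℝ) ∈ Icc |y| (1 - |y|) := hyx.symm ▸ I.M_mem_Icc hM a b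
  let ν := Function.update I.μ i (if i ∈ I.pos then τ - 1 else τ)
  have hν (a : Fin K) : τ ≤ ν a ↔ a ∈ symmDiff I.pos {i} := by
    rw [Finset.mem_symmDiff, Finset.mem_singleton]
    rcases eq_or_ne a i with rfl | hai
    · simp only [ν, Function.update_self]
      split_ifs with h <;> simp [h]
    · simp [ν, hai, mem_pos]
  refine ⟨⟨shift I.M i y, ν, fun a b => ?_, fun a b ha hb => ?_⟩, y, hyx, rfl, ?_⟩
  · rw [coe_shift hMy, coe_shift hMy, I.M_symm a b]
    ring
  · exact bordaScore_shift_lt hu hl hx hgap hy hMy ((hν a).mp ha) (mt (hν b).mpr hb.not_ge)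
  · ext a
    rw [mem_pos, hν]

end Problem

namespace Algorithm

theorem numDuels_eq_top (A : Algorithm K Ξ) (hA : A.UsesOnlyDuels)
    {x : Ξ × (ℕ × Query K → ℝ)} (h : ∀ S, ¬ A.Outputs x S) : A.numDuels x = ∞ := by
  have hreaches (t : ℕ) : A.Reaches x t := by
    induction t with
    | zero => exact A.reaches_zero x
    | succ t ih => exact (A.reaches_succ x t).mpr ⟨ih, fun S hS => h S ⟨t, ih, hS⟩⟩
  have hduel (t : ℕ) : ∃ i j, A.decision x t = .query (.duel i j) := by
    rcases hd : A.decision x t with (i | ⟨i, j⟩) | S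
    · exact absurd hd (hA t _ i)
    · exact ⟨i, j, rfl⟩
    · exact absurd ⟨t, hreaches t, hd⟩ (h S)
  simp [numDuels, hreaches, hduel]

theorem le_runLaw_outputs_pos (A : Algorithm K Ξ) (hA : A.UsesOnlyDuels) {ρ : Measure Ξ}
    [IsProbabilityMeasure ρ] {R δ : ℝ} (hδ : 0 ≤ δ) {I : Problem K τ} (herr : A.ErrsAtMost ρ R δ I)
    (hfin : A.expectedDuels ρ R I ≠ ∞) :
    ENNReal.ofReal (1 - δ) ≤ I.runLaw R ρ {x | A.Outputs x I.pos} := by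
  have hhalts : ∀ᵐ x ∂(I.runLaw R ρ), ∃ S, A.Outputs x S := by
    filter_upwards [ae_lt_top A.measurable_numDuels hfin] with x hx
    by_contra! h
    exact hx.ne (A.numDuels_eq_top hA h)
  have hcover : (univ : Set _) ≤ᵐ[I.runLaw R ρ]
      ({x | A.Outputs x I.pos} ∪ {x | ∃ S, A.Outputs x S ∧ S ≠ I.pos} : Set _) := by
    filter_upwards [hhalts] with x ⟨S, hS⟩ _
    rcases eq_or_ne S I.pos with rfl | hne
    · exact .inl hS
    · exact .inr ⟨S, hS, hne⟩
  rw [ENNReal.ofReal_sub _ hδ, ENNReal.ofReal_one, tsub_le_iff_right,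
    ← measure_univ (μ := I.runLaw R ρ)]
  exact (measure_mono_ae hcover).trans ((measure_union_le _ _).trans (by gcongr; exact herr))

theorem ofReal_bernoulliKL_le_mul_occupation_duelsOf (A : Algorithm K Ξ) (hA : A.UsesOnlyDuels)
    {ρ : Measure Ξ} [IsProbabilityMeasure ρ] {R δ : ℝ} (hδ0 : 0 < δ) (hδ : δ ≤ 1 / 2)
    {I J : Problem K τ} (hI : A.ErrsAtMost ρ R δ I) (hJ : A.ErrsAtMost ρ R δ J)
    (hfin : A.expectedDuels ρ R I ≠ ∞) (hpos : I.pos ≠ J.pos) {i : Fin K} {w y : ℝ} (hw : 0 < w)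
    (hM : ∀ a b, w + |y| ≤ I.M a b) (hshift : J.M = shift I.M i y) :
    ENNReal.ofReal (bernoulliKL (1 - δ) δ) ≤ ENNReal.ofReal (y ^ 2 / (2 * (w * (1 - w)))) *
      A.occupation (I.runLaw R ρ) (Decision.duelsOf i) := by
  have hIM := I.M_mem_Icc hM
  have hI01 (a b : Fin K) : (I.M a b : ℝ) ∈ Ioo 0 1 :=
    ⟨by linarith [(hIM a b).1, abs_nonneg y], by linarith [(hIM a b).2, abs_nonneg y]⟩
  have hJ01 (a b : Fin K) : (J.M a b : ℝ) ∈ Ioo 0 1 := by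
    have h := shift_mem_Icc hw.le hIM i a b
    rw [hshift]
    exact ⟨by linarith [h.1], by linarith [h.2]⟩
  have hJout : J.runLaw R ρ {x | A.Outputs x I.pos} ≤ ENNReal.ofReal δ :=
    le_trans (measure_mono (t := {x | ∃ S, A.Outputs x S ∧ S ≠ J.pos})
      fun _ hx => ⟨I.pos, hx, hpos⟩) hJ
  calc ENNReal.ofReal (bernoulliKL (1 - δ) δ)
      ≤ ∫⁻ d, Decision.answerKL I.M J.M d ∂(A.occupation (I.runLaw R ρ)) :=
        A.ofReal_bernoulliKL_le_lintegral_answerKL hA hI01 hJ01 R ρ hδ0 hδ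
          (A.le_runLaw_outputs_pos hA hδ0.le hI hfin) hJout
    _ ≤ _ := hshift ▸ lintegral_answerKL_shift_le _ hw hIM i

theorem inv_gap_sq_mul_bernoulliKL_le (A : Algorithm K Ξ) (hA : A.UsesOnlyDuels) {ρ : Measure Ξ}
    [IsProbabilityMeasure ρ] {R δ η : ℝ} (hδ0 : 0 < δ) (hδ : δ ≤ 1 / 2) (hη : 1 / 3 < η)
    {u l i : Fin K} (hcorrect : ∀ J : Problem K τ, u ∈ J.pos → l ∉ J.pos → A.ErrsAtMost ρ R δ J)
    {I : Problem K τ} (hu : I.IsWorstPositive u) (hl : I.IsBestNegative l)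
    (hM : ∀ a b, η ≤ I.M a b) (hfin : A.expectedDuels ρ R I ≠ ∞) (hiu : i ≠ u) (hil : i ≠ l) :
    (ENNReal.ofReal (I.gap u l i ^ 2))⁻¹ * ENNReal.ofReal (bernoulliKL (1 - δ) δ) ≤
      ENNReal.ofReal (1 / (2 * ((3 * η - 1) * (2 - 3 * η)))) *
        A.occupation (I.runLaw R ρ) (Decision.duelsOf i) := by
  have hη' := Problem.lt_half_of_le_M hu.1 hl.1 hM
  refine inv_sq_mul_le (Problem.gap_nonneg hu hl i) (Problem.gap_le hu.1 hl.1 hM i) (by linarith)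
    fun x hx hxη hgap => ?_
  obtain ⟨J, y, hyx, hJM, hJpos⟩ :=
    Problem.exists_flip hu hl hx hgap fun a b => by linarith [hM a b]
  have hw : 0 < 3 * η - 1 := by linarith
  have hIJ : I.pos ≠ J.pos := by simp [hJpos, eq_comm (a := I.pos)]
  have hJ : A.ErrsAtMost ρ R δ J := hcorrect J
    (by simp [hJpos, Finset.mem_symmDiff, hu.1, hiu.symm])
    (by simp [hJpos, Finset.mem_symmDiff, hl.1, hil.symm])
  have hconst : x ^ 2 / (2 * ((3 * η - 1) * (1 - (3 * η - 1)))) =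
      x ^ 2 * (1 / (2 * ((3 * η - 1) * (2 - 3 * η)))) := by ring
  have h := A.ofReal_bernoulliKL_le_mul_occupation_duelsOf hA hδ0 hδ (hcorrect I hu.1 hl.1) hJ hfin
    hIJ hw (fun a b => by linarith [hM a b]) hJM
  rwa [← sq_abs y, hyx, hconst, ENNReal.ofReal_mul (sq_nonneg x), mul_assoc] at h

end Algorithm

end TBPDC

theorem corollary1_general {K : ℕ} {Ξ : Type*} [MeasurableSpace Ξ] (ρ : Measure Ξ)
    [IsProbabilityMeasure ρ] (τ R δ η : ℝ) (hδ0 : 0 < δ) (hδ : δ ≤ 1 / 2) (hη : 1 / 3 < η)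
    (u l : Fin K) (A : TBPDC.Algorithm K Ξ) (hduel : A.UsesOnlyDuels)
    (hA : ∀ J : TBPDC.Problem K τ, u ∈ J.pos → l ∉ J.pos → A.ErrsAtMost ρ R δ J)
    (I : TBPDC.Problem K τ) (hu : I.IsWorstPositive u) (hl : I.IsBestNegative l)
    (hM : ∀ i j, η ≤ I.M i j) :
    ENNReal.ofReal ((3 * η - 1) * (2 - 3 * η)) * I.Hc1 u l *
        ENNReal.ofReal (TBPDC.bernoulliKL (1 - δ) δ) ≤ A.expectedDuels ρ R I := by
  by_cases hfin : A.expectedDuels ρ R I = ∞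
  · exact hfin.symm ▸ le_top
  have hη' := TBPDC.Problem.lt_half_of_le_M hu.1 hl.1 hM
  have hc : 0 < (3 * η - 1) * (2 - 3 * η) := mul_pos (by linarith) (by linarith)
  set c := (3 * η - 1) * (2 - 3 * η)
  have hsum : I.Hc1 u l * ENNReal.ofReal (TBPDC.bernoulliKL (1 - δ) δ) ≤
      ENNReal.ofReal (1 / (2 * c)) * (2 * A.expectedDuels ρ R I) := by
    rw [TBPDC.Problem.Hc1, Finset.sum_mul, TBPDC.Algorithm.expectedDuels, ← A.occupation_duels]
    refine le_trans ?_ (mul_le_mul_right (TBPDC.sum_measure_duelsOf_le _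
      ((Finset.univ.erase u).erase l)) _)
    rw [Finset.mul_sum]
    refine Finset.sum_le_sum fun i hi => ?_
    simp only [Finset.mem_erase] at hi
    exact A.inv_gap_sq_mul_bernoulliKL_le hduel hδ0 hδ hη hA hu hl hM hfin hi.2.1 hi.1
  rw [mul_assoc]
  refine (mul_le_mul_right hsum _).trans_eq ?_
  rw [← mul_assoc, ← mul_assoc, ← ENNReal.ofReal_mul hc.le, ← ENNReal.ofReal_ofNat 2,
    ← ENNReal.ofReal_mul (by positivity)]
  have hone : c * (1 / (2 * c)) * 2 = 1 := by field_simp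
  rw [hone, ENNReal.ofReal_one, one_mul]

theorem corollary1 {K : ℕ} {Ξ : Type*} [MeasurableSpace Ξ] (ρ : Measure Ξ) [IsProbabilityMeasure ρ]
    (τ R δ : ℝ) (hR : 0 < R) (hδ0 : 0 < δ) (hδ : δ ≤ 0.15)
    (u l : Fin K)
    (A : TBPDC.Algorithm K Ξ) (hduel : A.UsesOnlyDuels)
    (hA : ∀ J : TBPDC.Problem K τ, u ∈ J.pos → l ∉ J.pos → A.ErrsAtMost ρ R δ J)
    (I : TBPDC.Problem K τ) (hu : I.IsWorstPositive u) (hl : I.IsBestNegative l)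
    (hM : ∀ i j, (3 / 8 : ℝ) ≤ I.M i j) :
    ENNReal.ofReal (min (1 / 10) (R ^ 2 / 2)) * I.Hc1 u l * ENNReal.ofReal (Real.log (1 / (2 * δ)))
      ≤ A.expectedDuels ρ R I := by
  refine le_trans ?_ (corollary1_general ρ τ R δ (3 / 8) hδ0 (hδ.trans (by norm_num)) (by norm_num)
    u l A hduel hA I hu hl hM)
  gcongr
  · exact (min_le_left _ _).trans (by norm_num)
  · exact TBPDC.log_one_div_two_mul_le_bernoulliKL hδ0 hδ
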